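/- **Model.** A finite set of tasks $\tau_i$ shares a finite set of resources $\ell_q$. Task $\tau_i$ has a finite acyclic graph with a unique source (head) and a unique sink (tail), vertex worst-case execution times $c(v)\ge 0$ (which include lock-holding time but not spinning time), a period $T_i$ and a relative deadline $D_i$ with $0<D_i\le T_i$. Let $\mathcal C_i=\sum_v c(v)$ and let $\mathcal L_i$ be the largest total $c$ along a path from head to tail. Consecutive releases of jobs of $\tau_i$ are at least $T_i$ apart. Each vertex of a job executes for at most $c(v)$ time units. $\Theta_i$ is the set of resources accessed by $\tau_i$; a job of $\tau_i$ accesses $\ell_q$ at most $N_{i,q}$ times, each access having positive length at most $L_{i,q}$ and lying within one vertex; accesses are not nested. Task $\tau_i$ runs exclusively on $m_i\ge 1$ dedicated processors under a work-conserving scheduler: whenever an unfinished vertex of a released job whose predecessors are all finished is neither executing nor spinning, all $m_i$ processors are busy. Each resource is protected by a spin lock, held by at most one vertex in the whole system at any time; a vertex that requests a lock held by another vertex (of the same or of another task) spins until it obtains it; a vertex is not preempted while it spins or holds a lock; waiting requests are served in an arbitrary order (unordered). The response time of a job is its finish time minus its release time, and the worst-case response time $R_i$ of $\tau_i$ is the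 supremum of the response times of its released jobs. **Theorem.** Put $$\eta_{i,j}^q=\begin{cases}\left\lceil \dfrac{D_i+D_j}{T_j}\right\rceil & \text{if } \ell_q\in\Theta_i\cap\Theta_j,\\[1ex] 0 & \text{otherwise,}\end{cases}$$ $$\mathcal B_i=\frac{\mathcal C_i+(m_i-1)\Bigl(\mathcal L_i+\sum_{\ell_q\in\Theta_i}N_{i,q}L_{i,q}\Bigr)}{m_i}+\sum_{j\ne i}\ \sum_{\ell_q\in\Theta_i}\eta_{i,j}^q\,N_{j,q}\,L_{j,q}.$$ Suppose that every task $\tau_k$ is schedulable ($R_k\le D_k$) or satisfies $\mathcal B_k\le D_k$. Then $R_i\le \mathcal B_i$ for every task $\tau_i$. -/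

import Mathlib

open MeasureTheory

noncomputable section

namespace SpinLock

/-- A system of DAG tasks (indexed by `ι`) sharing resources (indexed by `ρ`) under federated
scheduling; `V i` is the vertex set of task `i`. -/
structure TaskSystem (ι ρ : Type*) (V : ι → Type*) where
  /-- `edge i u v`: `u` is a predecessor of `v` in the graph of task `i` -/
  edge : ∀ i, V i → V i → Prop
  acyclic : ∀ i v, ¬ Relation.TransGen (edge i) v v
  head : ∀ i, V i
  tail : ∀ i, V i
  /-- the head is the only vertex without predecessors -/
  head_iff : ∀ i v, (∀ u, ¬ edge i u v) ↔ v = head i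
  /-- the tail is the only vertex without successors -/
  tail_iff : ∀ i v, (∀ w, ¬ edge i v w) ↔ v = tail i
  /-- worst-case execution time of a vertex: includes lock holding, excludes spinning -/
  wcet : ∀ i, V i → ℝ
  wcet_nonneg : ∀ i v, 0 ≤ wcet i v
  /-- `T i` -/
  period : ι → ℝ
  /-- relative deadline `D i` -/
  deadline : ι → ℝ
  deadline_pos : ∀ i, 0 < deadline i
  deadline_le_period : ∀ i, deadline i ≤ period i
  /-- the number `m i` of processors dedicated to task `i` -/
  procs : ι → ℕ
  procs_pos : ∀ i, 0 < procs i
  /-- `Θ i`, the resources that task `i` accesses -/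
  resources : ι → Finset ρ
  /-- `N i q`, the worst-case number of accesses to `q` by a job of task `i` -/
  numAccess : ι → ρ → ℕ
  /-- `L i q`, the worst-case duration of a single access to `q` by task `i` -/
  accessTime : ι → ρ → ℝ
  accessTime_nonneg : ∀ i q, 0 ≤ accessTime i q

/-- One access to resource `res` by a vertex: the vertex must hold the lock of `res` exactly
while the amount of execution it has received lies in `[start, start + len)`. -/
structure CritSection (ρ : Type*) where
  res : ρ
  start : ℝ
  len : ℝ

/-- What a processor is doing: idle, executing vertex `v` of the `k`-th job (with or without
a lock), or spinning on behalf of that vertex. -/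
inductive ProcState (V : Type*) where
  | idle : ProcState V
  | executing (k : ℕ) (v : V) : ProcState V
  | spinning (k : ℕ) (v : V) : ProcState V

variable {ι ρ : Type*} {V : ι → Type*}

namespace TaskSystem

/-- Total worst-case execution time of task `i`. -/
def totalWork [∀ i, Fintype (V i)] (S : TaskSystem ι ρ V) (i : ι) : ℝ :=
  ∑ v, S.wcet i v

/-- Complete paths of the graph of task `i`, from the head to the tail. -/
def IsCompletePath (S : TaskSystem ι ρ V) (i : ι) (l : List (V i)) : Prop :=
  l.IsChain (S.edge i) ∧ l.head? = some (S.head i) ∧ l.getLast? = some (S.tail i)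

/-- The length of the longest complete path of task `i`. -/
def longestPath (S : TaskSystem ι ρ V) (i : ι) : ℝ :=
  sSup {x | ∃ l, S.IsCompletePath i l ∧ x = (l.map (S.wcet i)).sum}

/-- The bound on the number of jobs of task `j` contending for `q` with a job of task `i`. -/
def eta [DecidableEq ρ] (S : TaskSystem ι ρ V) (i j : ι) (q : ρ) : ℕ :=
  if q ∈ S.resources i ∧ q ∈ S.resources j then
    ⌈(S.deadline i + S.deadline j) / S.period j⌉₊
  else 0

/-- The response time bound of task `i` for unordered spin locks. -/
def unorderedBound [Fintype ι] [DecidableEq ι] [DecidableEq ρ] [∀ i, Fintype (V i)]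
    (S : TaskSystem ι ρ V) (i : ι) : ℝ :=
  (S.totalWork i + ((S.procs i : ℝ) - 1) *
      (S.longestPath i + ∑ q ∈ S.resources i, (S.numAccess i q : ℝ) * S.accessTime i q))
    / (S.procs i : ℝ)
  + ∑ j ∈ Finset.univ.erase i, ∑ q ∈ S.resources i,
      (S.eta i j q : ℝ) * (S.numAccess j q : ℝ) * S.accessTime j q

end TaskSystem

/-- The jobs released at run time, and the actual demand of each of them. The jobs of task `i`
are numbered by the set `released i`, in order of release. -/
structure Workload [DecidableEq ρ] [∀ i, Fintype (V i)] (S : TaskSystem ι ρ V) where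
  released : ι → Set ℕ
  release : ι → ℕ → ℝ
  separation : ∀ i, ∀ k ∈ released i, ∀ l ∈ released i, k < l →
    release i k + S.period i ≤ release i l
  /-- actual execution time of a vertex of a job -/
  execTime : ∀ i, ℕ → V i → ℝ
  execTime_nonneg : ∀ i k v, 0 ≤ execTime i k v
  execTime_le : ∀ i k v, execTime i k v ≤ S.wcet i v
  /-- the accesses made by a vertex of a job -/
  sections : ∀ i, ℕ → V i → List (CritSection ρ)
  sections_res : ∀ i k v, ∀ s ∈ sections i k v, s.res ∈ S.resources i
  sections_start : ∀ i k v, ∀ s ∈ sections i k v, 0 ≤ s.start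
  sections_len_pos : ∀ i k v, ∀ s ∈ sections i k v, 0 < s.len
  sections_len_le : ∀ i k v, ∀ s ∈ sections i k v, s.len ≤ S.accessTime i s.res
  /-- an access does not extend beyond its vertex -/
  sections_end : ∀ i k v, ∀ s ∈ sections i k v, s.start + s.len ≤ execTime i k v
  /-- accesses of a vertex are listed in order and are not nested -/
  sections_disjoint : ∀ i k v,
    (sections i k v).Pairwise fun s s' => s.start + s.len ≤ s'.start
  sections_count : ∀ i k q,
    ∑ v, (sections i k v).countP (fun s => decide (s.res = q)) ≤ S.numAccess i q

namespace Workload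

variable [DecidableEq ρ] [∀ i, Fintype (V i)] {S : TaskSystem ι ρ V}

/-- An assignment of a state to each processor at each time; `Fin (S.procs i)` are the
processors dedicated to task `i`, which only serve vertices of task `i`. -/
abbrev Trace (_W : Workload S) : Type _ :=
  ∀ i, Fin (S.procs i) → ℝ → ProcState (V i)

variable (W : Workload S) (σ : W.Trace)

/-- Vertex `v` of job `k` of task `i` is executing at time `t`. -/
def Executing (i : ι) (k : ℕ) (v : V i) (t : ℝ) : Prop :=
  ∃ p, σ i p t = .executing k v

/-- Processor `p` is busy with vertex `v` of job `k` of task `i` at time `t`. -/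
def BusyWith (i : ι) (p : Fin (S.procs i)) (k : ℕ) (v : V i) (t : ℝ) : Prop :=
  σ i p t = .executing k v ∨ σ i p t = .spinning k v

/-- The amount of execution that a vertex has received before time `t`. -/
def progress (i : ι) (k : ℕ) (v : V i) (t : ℝ) : ℝ :=
  volume.real ({s | W.Executing σ i k v s} ∩ Set.Ico (W.release i k) t)

/-- Vertex `v` of job `k` is finished at time `t`: it and all its ancestors have received
their execution time. -/
def VertexFinished (i : ι) (k : ℕ) (v : V i) (t : ℝ) : Prop :=
  W.release i k ≤ t ∧
    ∀ u, Relation.ReflTransGen (S.edge i) u v → W.execTime i k u ≤ W.progress σ i k u t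

/-- Vertex `v` of job `k` is eligible (and unfinished) at time `t`. -/
def Eligible (i : ι) (k : ℕ) (v : V i) (t : ℝ) : Prop :=
  k ∈ W.released i ∧ W.release i k ≤ t ∧
    (∀ u, S.edge i u v → W.VertexFinished σ i k u t) ∧ ¬ W.VertexFinished σ i k v t

/-- Vertex `v` of job `k` of task `i` holds the lock of `q` at time `t`. -/
def Holds (i : ι) (k : ℕ) (v : V i) (q : ρ) (t : ℝ) : Prop :=
  W.Executing σ i k v t ∧ ∃ s ∈ W.sections i k v, s.res = q ∧
    s.start ≤ W.progress σ i k v t ∧ W.progress σ i k v t < s.start + s.len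

/-- The traces produced by work-conserving federated scheduling with non-preemptive spin locks,
requests being served in an arbitrary order. -/
structure IsSchedule : Prop where
  measurable : ∀ i p x, MeasurableSet {t | σ i p t = x}
  /-- a vertex occupies at most one processor at a time -/
  one_proc : ∀ i p p' k v t, W.BusyWith σ i p k v t → W.BusyWith σ i p' k v t → p = p'
  /-- only eligible vertices execute or spin -/
  eligible : ∀ i p k v t, W.BusyWith σ i p k v t → W.Eligible σ i k v t
  /-- a lock is held by at most one vertex in the whole system -/
  mutex : ∀ i k v j l u q t, W.Holds σ i k v q t → W.Holds σ j l u q t →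
    (⟨i, k, v⟩ : Σ i, ℕ × V i) = ⟨j, l, u⟩
  /-- a vertex spins only when it is about to start an access to a resource whose lock is held
  (necessarily by another vertex, of the same or of another task) -/
  spinning : ∀ i p k v t, σ i p t = .spinning k v →
    ∃ s ∈ W.sections i k v, W.progress σ i k v t = s.start ∧
      ∃ j l u, W.Holds σ j l u s.res t
  /-- spinning is non-preemptive, until the lock is obtained -/
  spin_nonpreemptive : ∀ i p k v t t', t ≤ t' → σ i p t = .spinning k v →
    W.progress σ i k v t' = W.progress σ i k v t → W.BusyWith σ i p k v t'
  /-- execution is non-preemptive while a lock is held -/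
  hold_nonpreemptive : ∀ i p k v t t', t ≤ t' → σ i p t = .executing k v →
    ∀ s ∈ W.sections i k v, s.start ≤ W.progress σ i k v t →
      W.progress σ i k v t' < s.start + s.len → σ i p t' = .executing k v
  /-- an eligible vertex only waits when all processors of its task are busy -/
  work_conserving : ∀ i k v t, W.Eligible σ i k v t →
    (∃ p, W.BusyWith σ i p k v t) ∨ ∀ p, σ i p t ≠ .idle

/-- Job `k` of task `i` is finished at time `t`. -/
def JobFinished (i : ι) (k : ℕ) (t : ℝ) : Prop :=
  ∀ v, W.VertexFinished σ i k v t

/-- Finish time of a job (`⊤` if it never finishes). -/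
def finishTime (i : ι) (k : ℕ) : EReal :=
  sInf {x | ∃ t : ℝ, W.JobFinished σ i k t ∧ x = (t : EReal)}

/-- Response time of a job. -/
def responseTime (i : ι) (k : ℕ) : EReal :=
  W.finishTime σ i k - (W.release i k : EReal)

/-- Worst-case response time of task `i`, over all its released jobs. -/
def wcrt (i : ι) : EReal :=
  ⨆ k ∈ W.released i, W.responseTime σ i k

end Workload

end SpinLock

end

/-! Suppose a job of task `i` released at `r` is unfinished at `r + B`, where `B ≤ D_i`. Let `X` be
the part of the window in which another task holds a lock from `Θ_i`, `Y` the part in which the job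
itself holds one, and `A` the part in which a vertex of its critical path executes. Off `X ∪ Y` no
processor of the task spins, because a spinning vertex needs a lock holder. Off `X ∪ Y ∪ A` an
eligible critical vertex is waiting, so work conservation makes all `m` processors execute the job.
On `A ∪ Y` at least one does. Hence `m (B - |X|)` is at most the executed work plus `(m - 1) |A ∪
Y|` (`card_mul_measureReal_sub_le`). The executed work is strictly below `C` as the job is
unfinished, and `|A ∪ Y| ≤ L + ∑ N L`, which contradicts the definition of `B` once `|X|` is bounded
by the inter-task term.

The bound on `|X|` counts jobs by release time (`finite_and_ncard_le_of_separated`). It needs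
deadlines to be met only by jobs released strictly before `r`, so there is no circularity: strong
induction on the number of earlier released jobs, over all tasks, gives every deadline
(`jobFinished_of_deadline_lt`). -/

namespace SpinLock

/-! ### Covering inequality and elapsed time in a set -/

section Measure

/-- If every set `P p` covers the complement of `X ∪ G`, and the sets `P p` together cover
`G \ X`, then the total measure of the sets `P p` bounds the measure of the complement of `X`. -/
theorem card_mul_measureReal_sub_le {α : Type*} [MeasurableSpace α] (μ : Measure α)
    [IsFiniteMeasure μ] {m : ℕ} (hm : 0 < m) (P : Fin m → Set α) {G X : Set α}
    (hG : MeasurableSet G)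
    (hsome : ∀ᵐ t ∂μ, t ∉ X → t ∈ G → ∃ p, t ∈ P p)
    (hall : ∀ᵐ t ∂μ, t ∉ X → t ∉ G → ∀ p, t ∈ P p) :
    (m : ℝ) * (μ.real Set.univ - μ.real X) ≤
      ∑ p, μ.real (P p) + ((m : ℝ) - 1) * μ.real G := by
  have hm1 : (1 : ℝ) ≤ m := by exact_mod_cast hm
  -- `X` is not assumed measurable, so only subadditivity is available here; this direction
  -- suffices.
  have hcompl : μ.real Set.univ ≤ μ.real X + μ.real Xᶜ := by
    rw [← Set.union_compl_self X]
    exact measureReal_union_le _ _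
  have hsplit : μ.real Xᶜ = μ.real (Xᶜ ∩ G) + μ.real (Xᶜ \ G) :=
    (measureReal_inter_add_sdiff hG).symm
  have hGX : μ.real (Xᶜ ∩ G) ≤ μ.real G := measureReal_mono Set.inter_subset_right
  have hcover : μ.real (Xᶜ ∩ G) ≤ ∑ p, μ.real (P p ∩ G) := by
    refine le_trans ?_ (measureReal_iUnion_fintype_le (fun p => P p ∩ G))
    refine ENNReal.toReal_mono (measure_ne_top _ _) (measure_mono_ae ?_)
    filter_upwards [hsome] with t ht htG
    obtain ⟨p, hp⟩ := ht htG.1 htG.2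
    exact Set.mem_iUnion.2 ⟨p, hp, htG.2⟩
  have heach : (m : ℝ) * μ.real (Xᶜ \ G) ≤ ∑ p, μ.real (P p \ G) := by
    have : ∀ p ∈ Finset.univ, μ.real (Xᶜ \ G) ≤ μ.real (P p \ G) := by
      intro p _
      refine ENNReal.toReal_mono (measure_ne_top _ _) (measure_mono_ae ?_)
      filter_upwards [hall] with t ht htG
      exact ⟨ht htG.1 htG.2 p, htG.2⟩
    simpa using Finset.card_nsmul_le_sum _ _ _ this
  have hsum : ∑ p, μ.real (P p) = ∑ p, μ.real (P p ∩ G) + ∑ p, μ.real (P p \ G) := by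
    rw [← Finset.sum_add_distrib]
    exact Finset.sum_congr rfl fun p _ => (measureReal_inter_add_sdiff hG).symm
  -- Of the `m` copies of `μ (Xᶜ ∩ G)`, one is charged to the sets `P p` and the other `m - 1` to `μ
  -- G`.
  nlinarith [mul_le_mul_of_nonneg_left hGX (sub_nonneg.2 hm1)]

/-- Amount of time spent in `E` between `r` and `t`. -/
noncomputable def elapsed (E : Set ℝ) (r t : ℝ) : ℝ := volume.real (E ∩ Set.Ico r t)

theorem elapsed_ne_top (E : Set ℝ) (r t : ℝ) : volume (E ∩ Set.Ico r t) ≠ ⊤ :=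
  measure_ne_top_of_subset Set.inter_subset_right (by simp)

theorem elapsed_nonneg (E : Set ℝ) (r t : ℝ) : 0 ≤ elapsed E r t := measureReal_nonneg

theorem elapsed_mono (E : Set ℝ) (r : ℝ) : Monotone (elapsed E r) := fun _ t h =>
  measureReal_mono (Set.inter_subset_inter_right _ (Set.Ico_subset_Ico_right h))
    (elapsed_ne_top E r t)

theorem elapsed_le_add (E : Set ℝ) (r : ℝ) {s t : ℝ} (h : s ≤ t) :
    elapsed E r t ≤ elapsed E r s + (t - s) := by
  have hsub : E ∩ Set.Ico r t ⊆ (E ∩ Set.Ico r s) ∪ Set.Ico s t := by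
    rintro x ⟨hx, hx1, hx2⟩
    rcases lt_or_ge x s with hs | hs
    · exact Or.inl ⟨hx, hx1, hs⟩
    · exact Or.inr ⟨hs, hx2⟩
  have hfin : volume ((E ∩ Set.Ico r s) ∪ Set.Ico s t) ≠ ⊤ :=
    measure_union_ne_top (elapsed_ne_top E r s) (by simp)
  calc elapsed E r t ≤ volume.real ((E ∩ Set.Ico r s) ∪ Set.Ico s t) :=
        measureReal_mono hsub hfin
    _ ≤ elapsed E r s + volume.real (Set.Ico s t) := measureReal_union_le _ _
    _ = elapsed E r s + (t - s) := by rw [Real.volume_real_Ico_of_le h]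

/-- Elapsed time grows at most at unit rate, so it is 1-Lipschitz. -/
theorem continuous_elapsed (E : Set ℝ) (r : ℝ) : Continuous (elapsed E r) := by
  refine (LipschitzWith.of_le_add fun x y => ?_).continuous
  rcases le_total x y with h | h
  · exact (elapsed_mono E r h).trans (le_add_of_nonneg_right dist_nonneg)
  · rw [Real.dist_eq, abs_of_nonneg (sub_nonneg.2 h)]
    exact elapsed_le_add E r h

/-- The time spent in `E` while the elapsed time lies in `[a, b)` is at most `b - a`. -/
theorem measureReal_elapsed_mem_Ico_le {E : Set ℝ} (hE : MeasurableSet E) {r : ℝ}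
    (hr : E ⊆ Set.Ici r) {a b : ℝ} (hab : a ≤ b) {K : Set ℝ} (hK : Bornology.IsBounded K) :
    volume.real ((E ∩ elapsed E r ⁻¹' Set.Ico a b) ∩ K) ≤ b - a := by
  set G := (E ∩ elapsed E r ⁻¹' Set.Ico a b) ∩ K with hG
  rcases G.eq_empty_or_nonempty with h | hne
  · rw [h]
    simpa using hab
  have hbdd : Bornology.IsBounded G := hK.subset Set.inter_subset_right
  have hB := hbdd.bddBelow
  have hA := hbdd.bddAbove
  have hmaps : Set.MapsTo (elapsed E r) G (Set.Icc a b) := fun x hx =>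
    Set.Ico_subset_Icc_self hx.1.2
  -- The infimum and supremum of `G` may lie outside `G`, but by continuity the elapsed time there
  -- is still in `[a, b]`. Up to the null point `t₂`, `G` lies in `E ∩ [t₁, t₂)`, whose measure is
  -- the increment of elapsed time.
  have hclos := hmaps.closure (continuous_elapsed E r)
  rw [isClosed_Icc.closure_eq] at hclos
  have h1 := (hclos (csInf_mem_closure hne hB)).1
  have h2 := (hclos (csSup_mem_closure hne hA)).2
  set t₁ := sInf G
  set t₂ := sSup G
  have hr1 : r ≤ t₁ := le_csInf hne fun x hx => hr hx.1.1
  have h12 : t₁ ≤ t₂ := csInf_le_csSup hne hB hA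
  have hsub : G ⊆ (E ∩ Set.Ico t₁ t₂) ∪ {t₂} := by
    intro x hx
    rcases (le_csSup hA hx).lt_or_eq with h | h
    · exact Or.inl ⟨hx.1.1, csInf_le hB hx, h⟩
    · exact Or.inr h
  have hle : volume.real G ≤ volume.real (E ∩ Set.Ico t₁ t₂) := by
    have hfin : volume ((E ∩ Set.Ico t₁ t₂) ∪ {t₂}) ≠ ⊤ :=
      measure_union_ne_top (elapsed_ne_top E t₁ t₂) (by simp)
    refine (measureReal_mono hsub hfin).trans ((measureReal_union_le _ _).trans ?_)
    simp [measureReal_def]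
  have hadd : elapsed E r t₂ = elapsed E r t₁ + volume.real (E ∩ Set.Ico t₁ t₂) := by
    rw [elapsed, elapsed, ← measureReal_union _ (hE.inter measurableSet_Ico)
      (elapsed_ne_top E r t₁) (elapsed_ne_top E t₁ t₂), ← Set.inter_union_distrib_left,
      Set.Ico_union_Ico_eq_Ico hr1 h12]
    rw [Set.disjoint_left]
    rintro x ⟨-, hx⟩ ⟨-, hx'⟩
    exact absurd hx.2 (not_lt.2 hx'.1)
  linarith

end Measure

/-! ### Counting separated releases -/

section Counting

/-- Points at least `T` apart in an interval of length `L` number at most `⌈L / T⌉`. -/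
theorem finite_and_ncard_le_of_separated {A : Set ℕ} {f : ℕ → ℝ} {T : ℝ} (hT : 0 < T)
    (hsep : ∀ k ∈ A, ∀ l ∈ A, k < l → f k + T ≤ f l) (a L : ℝ) :
    {k | k ∈ A ∧ a ≤ f k ∧ f k < a + L}.Finite ∧
      {k | k ∈ A ∧ a ≤ f k ∧ f k < a + L}.ncard ≤ ⌈L / T⌉₊ := by
  set B := {k | k ∈ A ∧ a ≤ f k ∧ f k < a + L} with hB
  -- Cut the interval into half-open cells of length `T`: each contains at most one point, and at
  -- most `⌈L / T⌉` cells are met.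
  have hmaps : Set.MapsTo (fun k => ⌊(f k - a) / T⌋₊) B (Set.Iio ⌈L / T⌉₊) := by
    rintro k ⟨-, h1, h2⟩
    have : (f k - a) / T < L / T := by gcongr; linarith
    rw [Set.mem_Iio, Nat.floor_lt (div_nonneg (sub_nonneg.2 h1) hT.le)]
    exact this.trans_le (Nat.le_ceil _)
  have hlt : ∀ k ∈ B, ∀ l ∈ B, k < l → ⌊(f k - a) / T⌋₊ < ⌊(f l - a) / T⌋₊ := by
    rintro k ⟨hk, h1, -⟩ l ⟨hl, -, -⟩ hkl
    have h := hsep k hk l hl hkl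
    have h0 : 0 ≤ (f k - a) / T := div_nonneg (sub_nonneg.2 h1) hT.le
    have : (f k - a) / T + 1 ≤ (f l - a) / T := by
      rw [div_add_one hT.ne']
      gcongr
      linarith
    have h' := Nat.floor_mono this
    rw [Nat.floor_add_one h0] at h'
    omega
  have hinj : Set.InjOn (fun k => ⌊(f k - a) / T⌋₊) B := by
    intro k hk l hl hkl
    by_contra hne
    rcases lt_or_gt_of_ne hne with h | h
    · exact (hlt k hk l hl h).ne hkl
    · exact (hlt l hl k hk h).ne hkl.symm
  refine ⟨Set.Finite.of_injOn hmaps hinj (Set.finite_Iio _), ?_⟩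
  refine (Set.ncard_le_ncard_of_injOn _ hmaps hinj (Set.finite_Iio _)).trans ?_
  simp [Set.ncard_eq_toFinset_card']

/-- Separation makes `f` increasing on `A`, so its value at the least index is a lower bound and the
count on a bounded interval applies. This finiteness is what permits induction on earlier releases.
-/
theorem finite_setOf_lt_of_separated {A : Set ℕ} {f : ℕ → ℝ} {T : ℝ} (hT : 0 < T)
    (hsep : ∀ k ∈ A, ∀ l ∈ A, k < l → f k + T ≤ f l) (b : ℝ) :
    {k | k ∈ A ∧ f k < b}.Finite := by
  classical
  rcases A.eq_empty_or_nonempty with rfl | hne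
  · simp
  have hex : ∃ k, k ∈ A := hne
  have hmin : ∀ k ∈ A, f (Nat.find hex) ≤ f k := by
    intro k hk
    rcases (Nat.find_min' hex hk).lt_or_eq with h | h
    · linarith [hsep _ (Nat.find_spec hex) k hk h]
    · rw [h]
  refine (finite_and_ncard_le_of_separated hT hsep (f (Nat.find hex))
    (b - f (Nat.find hex))).1.subset ?_
  rintro k ⟨hk, hkb⟩
  exact ⟨hk, hmin k hk, by linarith⟩

end Counting

/-! ### Paths in the task graph -/

namespace TaskSystem

variable {ι ρ : Type*} {V : ι → Type*}

theorem period_pos (S : TaskSystem ι ρ V) (i : ι) : 0 < S.period i :=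
  (S.deadline_pos i).trans_le (S.deadline_le_period i)

theorem nodup_of_isChain (S : TaskSystem ι ρ V) (i : ι) {l : List (V i)} (h : l.IsChain (S.edge i)) : l.Nodup := by
  have h' : l.IsChain (Relation.TransGen (S.edge i)) :=
    h.imp fun _ _ => Relation.TransGen.single
  refine (List.isChain_iff_pairwise.1 h').imp ?_
  rintro a b hab rfl
  exact S.acyclic i a hab

theorem longestPath_nonneg (S : TaskSystem ι ρ V) (i : ι) : 0 ≤ S.longestPath i := by
  refine Real.sSup_nonneg ?_
  rintro x ⟨l, -, rfl⟩
  refine List.sum_nonneg ?_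
  simp only [List.mem_map]
  rintro _ ⟨v, -, rfl⟩
  exact S.wcet_nonneg i v

variable [∀ i, Fintype (V i)] (S : TaskSystem ι ρ V) (i : ι)

theorem wellFounded_edge : WellFounded (S.edge i) := by
  have : Std.Irrefl (Relation.TransGen (S.edge i)) := ⟨S.acyclic i⟩
  have hwf : WellFounded (Relation.TransGen (S.edge i)) :=
    Finite.wellFounded_of_trans_of_irrefl _
  exact Subrelation.wf (fun h => Relation.TransGen.single h) hwf

theorem wellFounded_swap_edge : WellFounded (Function.swap (S.edge i)) := by
  have : Std.Irrefl (Function.swap (Relation.TransGen (S.edge i))) := ⟨S.acyclic i⟩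
  have : IsTrans _ (Function.swap (Relation.TransGen (S.edge i))) :=
    ⟨fun _ _ _ h h' => Relation.TransGen.trans h' h⟩
  have hwf : WellFounded (Function.swap (Relation.TransGen (S.edge i))) :=
    Finite.wellFounded_of_trans_of_irrefl _
  refine Subrelation.wf (fun {u v} h => ?_) hwf
  exact Relation.TransGen.single (r := S.edge i) h

/-- Following successors must stop, and only at the unique sink. Hence a job is finished as soon as
its tail is. -/
theorem reflTransGen_tail (v : V i) : Relation.ReflTransGen (S.edge i) v (S.tail i) := by
  induction v using (S.wellFounded_swap_edge i).induction with
  | _ v ih =>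
    by_cases hv : v = S.tail i
    · rw [hv]
    · rw [← S.tail_iff i v] at hv
      push Not at hv
      obtain ⟨w, hw⟩ := hv
      exact Relation.ReflTransGen.head hw (ih w hw)

theorem sum_wcet_le_totalWork {l : List (V i)} (h : l.IsChain (S.edge i)) :
    (l.map (S.wcet i)).sum ≤ S.totalWork i := by
  classical
  rw [← List.sum_toFinset _ (S.nodup_of_isChain i h)]
  exact Finset.sum_le_sum_of_subset_of_nonneg (Finset.subset_univ _)
    fun v _ _ => S.wcet_nonneg i v

/-- The real supremum is meaningful because path lengths are bounded: by acyclicity a path repeats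
no vertex, so `totalWork` dominates it. -/
theorem sum_wcet_le_longestPath {l : List (V i)} (h : S.IsCompletePath i l) :
    (l.map (S.wcet i)).sum ≤ S.longestPath i := by
  refine le_csSup ⟨S.totalWork i, ?_⟩ ⟨l, h, rfl⟩
  rintro x ⟨l, hl, rfl⟩
  exact S.sum_wcet_le_totalWork i hl.1

theorem unorderedBound_nonneg [Fintype ι] [DecidableEq ι] [DecidableEq ρ] :
    0 ≤ S.unorderedBound i := by
  have hm : (1 : ℝ) ≤ S.procs i := by exact_mod_cast S.procs_pos i
  have hL := S.longestPath_nonneg i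
  have hC : 0 ≤ S.totalWork i := Finset.sum_nonneg fun v _ => S.wcet_nonneg i v
  have hN : ∀ j q, 0 ≤ (S.numAccess j q : ℝ) * S.accessTime j q := fun j q =>
    mul_nonneg (Nat.cast_nonneg _) (S.accessTime_nonneg j q)
  refine add_nonneg (div_nonneg (add_nonneg hC (mul_nonneg (sub_nonneg.2 hm)
    (add_nonneg hL (Finset.sum_nonneg fun q _ => hN i q)))) (Nat.cast_nonneg _)) ?_
  refine Finset.sum_nonneg fun j _ => Finset.sum_nonneg fun q _ => ?_
  rw [mul_assoc]
  exact mul_nonneg (Nat.cast_nonneg _) (hN j q)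

end TaskSystem

/-! ### The critical path -/

namespace Workload

variable {ι ρ : Type*} {V : ι → Type*} [DecidableEq ρ] [∀ i, Fintype (V i)]
  {S : TaskSystem ι ρ V} {W : Workload S} {σ : W.Trace}

theorem VertexFinished.mono {i : ι} {k : ℕ} {v : V i} {s t : ℝ}
    (h : W.VertexFinished σ i k v s) (hst : s ≤ t) : W.VertexFinished σ i k v t :=
  ⟨h.1.trans hst, fun u hu => (h.2 u hu).trans (elapsed_mono _ _ hst)⟩

/-- An eligible vertex has not received its execution time. -/
theorem Eligible.progress_lt {i : ι} {k : ℕ} {v : V i} {t : ℝ}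
    (h : W.Eligible σ i k v t) : W.progress σ i k v t < W.execTime i k v := by
  by_contra hlt
  refine h.2.2.2 ⟨h.2.1, fun u hu => ?_⟩
  rcases Relation.ReflTransGen.cases_tail hu with rfl | ⟨w, huw, hwv⟩
  · exact not_lt.1 hlt
  · exact (h.2.2.1 w hwv).2 u huw

/-- Every vertex `v` ends a path from the head that has an eligible vertex as long as `v` is
unfinished. -/
theorem exists_path_eligible {i : ι} {k : ℕ} (hk : k ∈ W.released i) (v : V i) :
    ∃ l : List (V i), l.IsChain (S.edge i) ∧ l.head? = some (S.head i) ∧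
      l.getLast? = some v ∧ ∀ t, W.release i k ≤ t → ¬ W.VertexFinished σ i k v t →
        ∃ w ∈ l, W.Eligible σ i k w t := by
  classical
  induction v using (S.wellFounded_edge i).induction with
  | _ v ih =>
    by_cases hv : v = S.head i
    · refine ⟨[v], List.isChain_singleton v, by simp [hv], by simp, fun t ht hf => ?_⟩
      refine ⟨v, by simp, hk, ht, fun u hu => ?_, hf⟩
      exact absurd hu ((S.head_iff i v).2 hv u)
    · have hex : ∃ u, S.edge i u v := by
        rw [← S.head_iff i v] at hv
        push Not at hv
        exact hv
      -- Choose a predecessor that finishes last. The sets of times at which vertices are finished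
      -- are upward closed, hence ordered by inclusion, so a minimal one is contained in all the
      -- others; this also covers vertices that never finish.
      obtain ⟨u, hu, hmin⟩ : ∃ u, S.edge i u v ∧ ∀ w, S.edge i w v → ∀ t,
          W.VertexFinished σ i k u t → W.VertexFinished σ i k w t := by
        obtain ⟨u, hu, hmin⟩ := Set.Finite.exists_minimalFor
          (fun u => {t | W.VertexFinished σ i k u t}) {u | S.edge i u v} (Set.toFinite _) hex
        refine ⟨u, hu, fun w hw t hut => ?_⟩
        by_contra hwt
        refine hwt (hmin hw (fun s hs => ?_) hut)
        refine hut.mono (not_lt.1 fun hst => hwt (VertexFinished.mono hs hst.le))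
      obtain ⟨l, hl, hhead, hlast, hcov⟩ := ih u hu
      refine ⟨l ++ [v], ?_, ?_, by simp, fun t ht hf => ?_⟩
      · refine hl.append (List.isChain_singleton v) ?_
        intro x hx y hy
        rw [hlast] at hx
        simp only [Option.mem_def, Option.some.injEq, List.head?_cons] at hx hy
        rwa [← hx, ← hy]
      · rw [List.head?_append, hhead]
        rfl
      · by_cases hut : W.VertexFinished σ i k u t
        · exact ⟨v, by simp, hk, ht, fun w hw => hmin w hw t hut, hf⟩
        · obtain ⟨w, hw, hwe⟩ := hcov t ht hut
          exact ⟨w, List.mem_append_left _ hw, hwe⟩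

/-- The critical path of a job: a complete path that has an eligible vertex as long as the
job is unfinished. -/
theorem exists_completePath_eligible {i : ι} {k : ℕ} (hk : k ∈ W.released i) :
    ∃ l : List (V i), S.IsCompletePath i l ∧ ∀ t, W.release i k ≤ t →
      ¬ W.JobFinished σ i k t → ∃ w ∈ l, W.Eligible σ i k w t := by
  obtain ⟨l, hl, hhead, hlast, hcov⟩ := exists_path_eligible (σ := σ) hk (S.tail i)
  refine ⟨l, ⟨hl, hhead, hlast⟩, fun t ht hf => hcov t ht fun htail => hf fun v => ?_⟩
  exact ⟨ht, fun u hu => htail.2 u (hu.trans (S.reflTransGen_tail i v))⟩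

/-! ### Execution and lock-holding times of one job -/

namespace IsSchedule

variable (hσ : W.IsSchedule σ)
include hσ

theorem eligible_of_executing {i : ι} {k : ℕ} {v : V i} {t : ℝ}
    (h : W.Executing σ i k v t) : W.Eligible σ i k v t := by
  obtain ⟨p, hp⟩ := h
  exact hσ.eligible i p k v t (Or.inl hp)

theorem measurableSet_executing (i : ι) (k : ℕ) (v : V i) :
    MeasurableSet {t | W.Executing σ i k v t} := by
  simp only [Executing, Set.ofPred_exists]
  exact MeasurableSet.iUnion fun p => hσ.measurable i p _

/-- The time during which a vertex executes an access is at most the length of the access. -/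
theorem measureReal_section_le (i : ι) (k : ℕ) (v : V i) {a b : ℝ} (hab : a ≤ b) {K : Set ℝ}
    (hK : Bornology.IsBounded K) :
    volume.real ({t | W.Executing σ i k v t ∧ a ≤ W.progress σ i k v t ∧
      W.progress σ i k v t < b} ∩ K) ≤ b - a :=
  measureReal_elapsed_mem_Ico_le (hσ.measurableSet_executing i k v)
    (fun _ ht => (hσ.eligible_of_executing ht).2.1) hab hK

/-- An executing vertex is eligible, so its progress stays in `[0, execTime)`; the bound for an
access applies to this whole range. -/
theorem measureReal_executing_le (i : ι) (k : ℕ) (v : V i) {K : Set ℝ}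
    (hK : Bornology.IsBounded K) :
    volume.real ({t | W.Executing σ i k v t} ∩ K) ≤ W.execTime i k v := by
  have h := hσ.measureReal_section_le i k v (W.execTime_nonneg i k v) hK
  rw [sub_zero] at h
  have heq : {t | W.Executing σ i k v t} = {t | W.Executing σ i k v t ∧
      0 ≤ W.progress σ i k v t ∧ W.progress σ i k v t < W.execTime i k v} :=
    Set.ext fun t => ⟨fun ht => ⟨ht, elapsed_nonneg _ _ _,
      (hσ.eligible_of_executing ht).progress_lt⟩, fun ht => ht.1⟩
  rwa [heq]

theorem progress_le_execTime (i : ι) (k : ℕ) (v : V i) (t : ℝ) :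
    W.progress σ i k v t ≤ W.execTime i k v :=
  hσ.measureReal_executing_le i k v (Metric.isBounded_Ico _ _)

theorem measurableSet_holds (i : ι) (k : ℕ) (v : V i) (q : ρ) :
    MeasurableSet {t | W.Holds σ i k v q t} := by
  refine (hσ.measurableSet_executing i k v).inter ?_
  have hcont : Continuous (W.progress σ i k v) := continuous_elapsed _ _
  have : {t | ∃ s ∈ W.sections i k v, s.res = q ∧ s.start ≤ W.progress σ i k v t ∧
      W.progress σ i k v t < s.start + s.len} =
      ⋃ s ∈ {s | s ∈ W.sections i k v ∧ s.res = q},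
        W.progress σ i k v ⁻¹' Set.Ico s.start (s.start + s.len) := by
    ext t
    simp only [Set.mem_ofPred_eq, Set.mem_iUnion, Set.mem_preimage, Set.mem_Ico, exists_prop,
      and_assoc]
  change MeasurableSet {t | ∃ s ∈ W.sections i k v, s.res = q ∧ s.start ≤ W.progress σ i k v t ∧
      W.progress σ i k v t < s.start + s.len}
  rw [this]
  refine MeasurableSet.biUnion ?_ fun s _ => hcont.measurable measurableSet_Ico
  exact (((W.sections i k v).finite_toSet).subset fun s hs => hs.1).countable

theorem measureReal_vertex_holds_le (i : ι) (k : ℕ) (v : V i) (q : ρ) {K : Set ℝ}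
    (hK : Bornology.IsBounded K) :
    volume.real ({t | W.Holds σ i k v q t} ∩ K) ≤
      ((W.sections i k v).countP (fun s => decide (s.res = q)) : ℝ) * S.accessTime i q := by
  -- Generalizing to lists of accesses of the vertex allows induction while the progress function
  -- stays fixed.
  have key : ∀ L : List (CritSection ρ), (∀ s ∈ L, s ∈ W.sections i k v) →
      volume.real ({t | W.Executing σ i k v t ∧ ∃ s ∈ L, s.res = q ∧
        s.start ≤ W.progress σ i k v t ∧ W.progress σ i k v t < s.start + s.len} ∩ K) ≤
      (L.countP (fun s => decide (s.res = q)) : ℝ) * S.accessTime i q := by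
    intro L
    induction L with
    | nil => simp
    | cons s L ih =>
      intro hL
      have hs := hL s (by simp)
      have ih' := ih fun s' hs' => hL s' (by simp [hs'])
      by_cases hq : s.res = q
      · have hlen : 0 ≤ s.len := (W.sections_len_pos i k v s hs).le
        have h1 := hσ.measureReal_section_le i k v (le_add_of_nonneg_right hlen) hK
          (a := s.start)
        have h2 : s.len ≤ S.accessTime i q := hq ▸ W.sections_len_le i k v s hs
        have hfin : ∀ A : Set ℝ, volume (A ∩ K) ≠ ⊤ := fun A =>
          measure_ne_top_of_subset Set.inter_subset_right hK.measure_lt_top.ne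
        have hsub := measureReal_mono (μ := volume) (s₁ := {t | W.Executing σ i k v t ∧
          ∃ s' ∈ s :: L, s'.res = q ∧ s'.start ≤ W.progress σ i k v t ∧
            W.progress σ i k v t < s'.start + s'.len} ∩ K)
          (s₂ := ({t | W.Executing σ i k v t ∧ s.start ≤ W.progress σ i k v t ∧
            W.progress σ i k v t < s.start + s.len} ∩ K) ∪
          ({t | W.Executing σ i k v t ∧ ∃ s' ∈ L, s'.res = q ∧
            s'.start ≤ W.progress σ i k v t ∧
            W.progress σ i k v t < s'.start + s'.len} ∩ K)) (by
            rintro t ⟨⟨he, s', hs', hq', hp⟩, htK⟩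
            rcases List.mem_cons.1 hs' with rfl | hs'
            · exact Or.inl ⟨⟨he, hp⟩, htK⟩
            · exact Or.inr ⟨⟨he, s', hs', hq', hp⟩, htK⟩)
          (measure_union_ne_top (hfin _) (hfin _))
        have hun := hsub.trans (measureReal_union_le _ _)
        rw [List.countP_cons_of_pos (by simpa using hq)]
        push_cast
        linarith
      · rw [List.countP_cons_of_neg (by simpa using hq)]
        convert ih' using 7 with t
        funext s'
        refine propext ⟨?_, fun h => ⟨List.mem_cons_of_mem _ h.1, h.2⟩⟩
        rintro ⟨hs', h⟩
        rcases List.mem_cons.1 hs' with rfl | hs'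
        · exact absurd h.1 hq
        · exact ⟨hs', h⟩
  exact key _ fun _ h => h

/-- A job holds the lock of `q` for at most `N * L` time units. -/
theorem measureReal_job_holds_le (i : ι) (k : ℕ) (q : ρ) {K : Set ℝ}
    (hK : Bornology.IsBounded K) :
    volume.real ({t | ∃ v, W.Holds σ i k v q t} ∩ K) ≤
      (S.numAccess i q : ℝ) * S.accessTime i q := by
  have : {t | ∃ v, W.Holds σ i k v q t} ∩ K = ⋃ v, {t | W.Holds σ i k v q t} ∩ K := by
    rw [Set.ofPred_exists, Set.iUnion_inter]
  rw [this]
  refine (measureReal_iUnion_fintype_le _).trans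
    ((Finset.sum_le_sum fun v _ => hσ.measureReal_vertex_holds_le i k v q hK).trans ?_)
  rw [← Finset.sum_mul]
  refine mul_le_mul_of_nonneg_right ?_ (S.accessTime_nonneg i q)
  exact_mod_cast W.sections_count i k q

end IsSchedule

/-- A job of a task whose worst-case response time is at most `D` is finished at all times more
than `D` after its release. -/
theorem jobFinished_of_wcrt_le {j : ι} {D : ℝ}
    (h : W.wcrt σ j ≤ (D : EReal)) {l : ℕ} (hl : l ∈ W.released j) {t : ℝ}
    (ht : W.release j l + D < t) : W.JobFinished σ j l t := by
  have hresp : W.responseTime σ j l ≤ (D : EReal) :=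
    (le_iSup₂ (f := fun l (_ : l ∈ W.released j) => W.responseTime σ j l) l hl).trans h
  rw [responseTime,
    EReal.sub_le_iff_le_add (Or.inl (EReal.coe_ne_bot _)) (Or.inl (EReal.coe_ne_top _)),
    ← EReal.coe_add] at hresp
  have hlt : W.finishTime σ j l < (t : EReal) :=
    hresp.trans_lt (EReal.coe_lt_coe_iff.2 (by linarith))
  obtain ⟨_, ⟨s, hs, rfl⟩, hst⟩ := sInf_lt_iff.1 hlt
  exact fun v => (hs v).mono (EReal.coe_lt_coe_iff.1 hst).le

/-- Only one job of a task is active in the window that follows its release, if the earlier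
jobs of the task meet their deadlines. -/
theorem eq_of_eligible {i : ι} {k k' : ℕ} (hk : k ∈ W.released i) {v : V i} {t : ℝ}
    (ht : W.release i k < t) (htD : t < W.release i k + S.deadline i)
    (hprev : ∀ l ∈ W.released i, W.release i l < W.release i k → ∀ t,
      W.release i l + S.deadline i < t → W.JobFinished σ i l t)
    (hel : W.Eligible σ i k' v t) : k' = k := by
  -- Since `D ≤ T`, an earlier job has its deadline no later than this release, and a later job is
  -- released no earlier than the end of the window.
  have hD := S.deadline_le_period i
  have hT := S.period_pos i
  rcases lt_trichotomy k' k with h | h | h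
  · have hsep := W.separation i k' hel.1 k hk h
    exact absurd (hprev k' hel.1 (by linarith) t (by linarith) v) hel.2.2.2
  · exact h
  · have hsep := W.separation i k hk k' hel.1 h
    linarith [hel.2.1]

/-! ### Interference, workload and the response-time argument -/

namespace IsSchedule

variable (hσ : W.IsSchedule σ)
include hσ

/-- In a window of length at most `D i` starting at `r`, jobs of task `j` hold the lock of `q`
for at most `η * N * L` time units, if the jobs of `j` released before `r` meet their
deadlines. -/
theorem measureReal_task_holds_le {i j : ι} {q : ρ} (hq : q ∈ S.resources i) {r b : ℝ}
    (hb : b ≤ r + S.deadline i)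
    (hprev : ∀ l ∈ W.released j, W.release j l < r → ∀ t, W.release j l + S.deadline j < t →
      W.JobFinished σ j l t) :
    volume.real ({t | ∃ l u, W.Holds σ j l u q t} ∩ Set.Ioo r b) ≤
      (S.eta i j q : ℝ) * (S.numAccess j q : ℝ) * S.accessTime j q := by
  have hNL : 0 ≤ (S.numAccess j q : ℝ) * S.accessTime j q :=
    mul_nonneg (Nat.cast_nonneg _) (S.accessTime_nonneg j q)
  by_cases hqj : q ∈ S.resources j
  -- A job of `j` holding the lock inside the window is unfinished there, so it was released at or
  -- after `r - D_j`, and before `r + D_i`. This range of length `D_i + D_j` produces `η`.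
  · obtain ⟨hfin, hcard⟩ := finite_and_ncard_le_of_separated (S.period_pos j)
      (W.separation j) (r - S.deadline j) (S.deadline i + S.deadline j)
    set F := {l | l ∈ W.released j ∧ r - S.deadline j ≤ W.release j l ∧
      W.release j l < r - S.deadline j + (S.deadline i + S.deadline j)}
    have hsub : {t | ∃ l u, W.Holds σ j l u q t} ∩ Set.Ioo r b ⊆
        ⋃ l ∈ hfin.toFinset, {t | ∃ u, W.Holds σ j l u q t} ∩ Set.Ioo r b := by
      rintro t ⟨⟨l, u, hu⟩, ht⟩
      have hel := hσ.eligible_of_executing hu.1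
      refine Set.mem_biUnion (x := l) ?_ ⟨⟨u, hu⟩, ht⟩
      refine hfin.mem_toFinset.2 ⟨hel.1, ?_, ?_⟩
      · by_contra hlt
        refine hel.2.2.2 (hprev l hel.1 ?_ t ?_ u)
        · linarith [S.deadline_pos j]
        · linarith [ht.1]
      · linarith [hel.2.1, ht.2]
    have hne : volume (⋃ l ∈ hfin.toFinset,
        {t | ∃ u, W.Holds σ j l u q t} ∩ Set.Ioo r b) ≠ ⊤ :=
      measure_ne_top_of_subset (Set.iUnion₂_subset fun _ _ => Set.inter_subset_right)
        (measure_Ioo_lt_top (a := r) (b := b)).ne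
    calc volume.real ({t | ∃ l u, W.Holds σ j l u q t} ∩ Set.Ioo r b)
        ≤ ∑ l ∈ hfin.toFinset, volume.real ({t | ∃ u, W.Holds σ j l u q t} ∩ Set.Ioo r b) :=
          (measureReal_mono hsub hne).trans (measureReal_biUnion_finset_le _ _)
      _ ≤ ∑ l ∈ hfin.toFinset, (S.numAccess j q : ℝ) * S.accessTime j q :=
          Finset.sum_le_sum fun l _ => hσ.measureReal_job_holds_le j l q
            (Metric.isBounded_Ioo r b)
      _ = (F.ncard : ℝ) * ((S.numAccess j q : ℝ) * S.accessTime j q) := by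
          rw [Finset.sum_const, nsmul_eq_mul, Set.ncard_eq_toFinset_card F hfin]
      _ ≤ (S.eta i j q : ℝ) * ((S.numAccess j q : ℝ) * S.accessTime j q) := by
          refine mul_le_mul_of_nonneg_right ?_ hNL
          rw [TaskSystem.eta, if_pos ⟨hq, hqj⟩]
          exact_mod_cast hcard
      _ = _ := (mul_assoc _ _ _).symm
  · have hempty : {t | ∃ l u, W.Holds σ j l u q t} = ∅ := by
      refine Set.eq_empty_of_forall_notMem ?_
      rintro t ⟨l, u, -, s, hs, rfl, -⟩
      exact hqj (W.sections_res j l u s hs)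
    rw [hempty, Set.empty_inter, measureReal_empty, mul_assoc]
    exact mul_nonneg (Nat.cast_nonneg _) hNL

/-- The execution on all processors is bounded by the progress of the vertices. -/
theorem sum_measureReal_executing_le (i : ι) (k : ℕ) (b : ℝ) :
    ∑ p, volume.real ({t | ∃ v, σ i p t = .executing k v} ∩ Set.Ioo (W.release i k) b) ≤
      ∑ v, W.progress σ i k v b := by
  set I := Set.Ioo (W.release i k) b
  have hfin : ∀ A : Set ℝ, volume (A ∩ I) ≠ ⊤ := fun A =>
    measure_ne_top_of_subset Set.inter_subset_right measure_Ioo_lt_top.ne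
  calc ∑ p, volume.real ({t | ∃ v, σ i p t = .executing k v} ∩ I)
      ≤ ∑ p, ∑ v, volume.real ({t | σ i p t = .executing k v} ∩ I) := by
        refine Finset.sum_le_sum fun p _ => ?_
        rw [Set.ofPred_exists, Set.iUnion_inter]
        exact measureReal_iUnion_fintype_le _
    _ = ∑ v, ∑ p, volume.real ({t | σ i p t = .executing k v} ∩ I) := Finset.sum_comm
    _ = ∑ v, volume.real ({t | W.Executing σ i k v t} ∩ I) := by
        refine Finset.sum_congr rfl fun v _ => ?_
        have : {t | W.Executing σ i k v t} ∩ I =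
            ⋃ p ∈ Finset.univ, {t | σ i p t = .executing k v} ∩ I := by
          simp only [Executing, Set.ofPred_exists, Set.iUnion_inter, Finset.mem_univ,
            Set.iUnion_true]
        rw [this, measureReal_biUnion_finset (h := fun p _ => hfin _)]
        -- A vertex occupies one processor at a time, so for a fixed vertex these sets are disjoint
        -- and parallel execution is not counted twice.
        · intro p _ p' _ hne
          refine Set.disjoint_left.2 fun t ht ht' => hne ?_
          exact hσ.one_proc i p p' k v t (Or.inl ht.1) (Or.inl ht'.1)
        · exact fun p _ => (hσ.measurable i p _).inter measurableSet_Ioo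
    _ ≤ ∑ v, W.progress σ i k v b :=
        Finset.sum_le_sum fun v _ => measureReal_mono
          (Set.inter_subset_inter_right _ Set.Ioo_subset_Ico_self) (elapsed_ne_top _ _ _)

/-- A job finishes within the response time bound, if the bound is at most the deadline and all
jobs released earlier meet their deadlines. -/
theorem jobFinished_of_previous [Fintype ι] [DecidableEq ι] {i : ι} {k : ℕ}
    (hk : k ∈ W.released i) (hBD : S.unorderedBound i ≤ S.deadline i)
    (hprev : ∀ j, ∀ l ∈ W.released j, W.release j l < W.release i k → ∀ t,
      W.release j l + S.deadline j < t → W.JobFinished σ j l t) :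
    W.JobFinished σ i k (W.release i k + S.unorderedBound i) := by
  classical
  by_contra hunf
  set r := W.release i k with hr
  set b := r + S.unorderedBound i with hb
  have hB0 := S.unorderedBound_nonneg i
  have hm : (1 : ℝ) ≤ S.procs i := by exact_mod_cast S.procs_pos i
  obtain ⟨l, hl, hcov⟩ := exists_completePath_eligible (σ := σ) hk
  -- The left end is excluded because an earlier job is known to be finished only strictly after its
  -- deadline, which may equal `r`.
  set μ := volume.restrict (Set.Ioo r b) with hμ
  have : IsFiniteMeasure μ := ⟨by simp [hμ]⟩
  have hμreal : ∀ A, μ.real A = volume.real (A ∩ Set.Ioo r b) := fun A =>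
    measureReal_restrict_apply' measurableSet_Ioo
  set A : Set ℝ := ⋃ v ∈ l.toFinset, {t | W.Executing σ i k v t} with hA
  set Y : Set ℝ := ⋃ q ∈ S.resources i, {t | ∃ v, W.Holds σ i k v q t} with hY
  set X : Set ℝ := ⋃ j ∈ Finset.univ.erase i, ⋃ q ∈ S.resources i,
    {t | ∃ l u, W.Holds σ j l u q t} with hX
  have hownjob : ∀ t ∈ Set.Ioo r b, ∀ k' v, W.Eligible σ i k' v t → k' = k :=
    fun t ht k' v => eq_of_eligible hk ht.1 (by linarith [ht.2]) (hprev i)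
  have hAm : MeasurableSet A :=
    Finset.measurableSet_biUnion _ fun v _ => hσ.measurableSet_executing i k v
  have hYm : MeasurableSet Y := by
    refine Finset.measurableSet_biUnion _ fun q _ => ?_
    rw [Set.ofPred_exists]
    exact MeasurableSet.iUnion fun v => hσ.measurableSet_holds i k v q
  -- The holder that blocks a spinning vertex belongs either to another task, which puts `t` in `X`,
  -- or to task `i`, hence to job `k`, the only active one, which puts `t` in `Y`.
  have hspin : ∀ t ∈ Set.Ioo r b, t ∉ X → t ∉ Y → ∀ p k' v, σ i p t ≠ .spinning k' v := by
    intro t ht htX htY p k' v hp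
    obtain ⟨s, hs, -, j, l', u, hu⟩ := hσ.spinning i p k' v t hp
    have hres := W.sections_res i k' v s hs
    by_cases hj : j = i
    · subst hj
      obtain rfl := hownjob t ht l' u (hσ.eligible_of_executing hu.1)
      exact htY (Set.mem_biUnion hres ⟨u, hu⟩)
    · exact htX (Set.mem_biUnion (Finset.mem_coe.2 (Finset.mem_erase.2 ⟨hj, Finset.mem_univ j⟩))
        (Set.mem_biUnion hres ⟨l', u, hu⟩))
  have hwork := card_mul_measureReal_sub_le μ (S.procs_pos i)
    (fun p => {t | ∃ v, σ i p t = .executing k v}) (hAm.union hYm) (X := X)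
    (by
      refine Filter.Eventually.of_forall fun t _ ht => ?_
      rcases ht with ht | ht
      · obtain ⟨v, -, p, hp⟩ := Set.mem_iUnion₂.1 ht
        exact ⟨p, v, hp⟩
      · obtain ⟨q, -, v, ⟨p, hp⟩, -⟩ := Set.mem_iUnion₂.1 ht
        exact ⟨p, v, hp⟩)
    (by
      filter_upwards [ae_restrict_mem measurableSet_Ioo] with t ht htX htG p
      have hns := hspin t ht htX fun h => htG (Or.inr h)
      have hunft : ¬ W.JobFinished σ i k t := fun h => hunf fun v => (h v).mono ht.2.le
      obtain ⟨w, hw, hwe⟩ := hcov t ht.1.le hunft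
      rcases hσ.work_conserving i k w t hwe with ⟨p', hp' | hp'⟩ | hbusy
      · exact (htG (Or.inl (Set.mem_iUnion₂.2 ⟨w, List.mem_toFinset.2 hw, p', hp'⟩))).elim
      · exact absurd hp' (hns p' k w)
      · rcases hp : σ i p t with _ | ⟨k', v⟩ | ⟨k', v⟩
        · exact absurd hp (hbusy p)
        · obtain rfl := hownjob t ht k' v (hσ.eligible i p k' v t (Or.inl hp))
          exact ⟨v, rfl⟩
        · exact absurd hp (hns p k' v))
  have huniv : μ.real Set.univ = S.unorderedBound i := by
    rw [hμreal, Set.univ_inter, Real.volume_real_Ioo_of_le (by linarith)]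
    ring
  have hAle : μ.real A ≤ S.longestPath i := by
    calc μ.real A ≤ ∑ v ∈ l.toFinset, μ.real {t | W.Executing σ i k v t} :=
          measureReal_biUnion_finset_le _ _
      _ ≤ ∑ v ∈ l.toFinset, S.wcet i v := Finset.sum_le_sum fun v _ => by
          rw [hμreal]
          exact (hσ.measureReal_executing_le i k v (Metric.isBounded_Ioo r b)).trans
            (W.execTime_le i k v)
      _ = (l.map (S.wcet i)).sum := List.sum_toFinset _ (S.nodup_of_isChain i hl.1)
      _ ≤ S.longestPath i := S.sum_wcet_le_longestPath i hl
  have hYle : μ.real Y ≤ ∑ q ∈ S.resources i, (S.numAccess i q : ℝ) * S.accessTime i q := by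
    refine (measureReal_biUnion_finset_le _ _).trans (Finset.sum_le_sum fun q _ => ?_)
    rw [hμreal]
    exact hσ.measureReal_job_holds_le i k q (Metric.isBounded_Ioo r b)
  have hXle : μ.real X ≤ ∑ j ∈ Finset.univ.erase i, ∑ q ∈ S.resources i,
      (S.eta i j q : ℝ) * (S.numAccess j q : ℝ) * S.accessTime j q := by
    refine (measureReal_biUnion_finset_le _ _).trans (Finset.sum_le_sum fun j _ => ?_)
    refine (measureReal_biUnion_finset_le _ _).trans (Finset.sum_le_sum fun q hq => ?_)
    rw [hμreal]
    exact hσ.measureReal_task_holds_le hq (by linarith) (hprev j)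
  -- Strictness comes from a vertex still short of its execution time at `b`; it yields the
  -- contradiction at exactly `r + B`.
  have hElt : ∑ p, μ.real {t | ∃ v, σ i p t = .executing k v} < S.totalWork i := by
    simp only [hμreal]
    refine (hσ.sum_measureReal_executing_le i k b).trans_lt ?_
    obtain ⟨u, hu⟩ : ∃ u, W.progress σ i k u b < W.execTime i k u := by
      by_contra! hall
      exact hunf fun v => ⟨by linarith, fun u _ => hall u⟩
    exact Finset.sum_lt_sum
      (fun v _ => (hσ.progress_le_execTime i k v b).trans (W.execTime_le i k v))
      ⟨u, Finset.mem_univ u, hu.trans_le (W.execTime_le i k u)⟩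
  have hGle : μ.real (A ∪ Y) ≤ S.longestPath i +
      ∑ q ∈ S.resources i, (S.numAccess i q : ℝ) * S.accessTime i q :=
    (measureReal_union_le _ _).trans (add_le_add hAle hYle)
  have hlt : μ.real Set.univ - μ.real X < (S.totalWork i + ((S.procs i : ℝ) - 1) *
      (S.longestPath i + ∑ q ∈ S.resources i, (S.numAccess i q : ℝ) * S.accessTime i q))
        / (S.procs i : ℝ) := by
    rw [lt_div_iff₀ (by linarith), mul_comm]
    have := mul_le_mul_of_nonneg_left hGle (sub_nonneg.2 hm)
    linarith
  rw [huniv] at hlt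
  nth_rewrite 1 [TaskSystem.unorderedBound] at hlt
  linarith

/-- All jobs meet their deadlines. -/
theorem jobFinished_of_deadline_lt [Fintype ι] [DecidableEq ι]
    (hdeadline : ∀ j, W.wcrt σ j ≤ ((S.deadline j : ℝ) : EReal) ∨
      S.unorderedBound j ≤ S.deadline j) {i : ι} {k : ℕ} (hk : k ∈ W.released i) {t : ℝ}
    (ht : W.release i k + S.deadline i < t) : W.JobFinished σ i k t := by
  have hfin : ∀ r : ℝ, {x : ι × ℕ | x.2 ∈ W.released x.1 ∧ W.release x.1 x.2 < r}.Finite := by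
    intro r
    have := Set.finite_iUnion fun j => (finite_setOf_lt_of_separated (S.period_pos j)
      (W.separation j) r).image (Prod.mk j)
    refine this.subset ?_
    rintro ⟨j, l⟩ h
    exact Set.mem_iUnion.2 ⟨j, l, h, rfl⟩
  -- Only strictly earlier releases are counted, so simultaneous jobs of different tasks need no
  -- tie-breaking. Passing to an earlier job lowers the count, as that job is no longer counted.
  induction hn : {x : ι × ℕ | x.2 ∈ W.released x.1 ∧ W.release x.1 x.2 < W.release i k}.ncard
    using Nat.strong_induction_on generalizing i k t with
  | _ n ih =>
    rcases hdeadline i with h | h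
    · exact jobFinished_of_wcrt_le h hk ht
    · refine fun v => (hσ.jobFinished_of_previous hk h ?_ v).mono (by linarith)
      intro j l hl hlr s hs
      refine ih _ ?_ hl hs rfl
      rw [← hn]
      refine Set.ncard_lt_ncard ⟨fun x hx => ⟨hx.1, hx.2.trans hlr⟩, fun hsub => ?_⟩ (hfin _)
      exact lt_irrefl _ (hsub (a := (j, l)) ⟨hl, hlr⟩).2

end IsSchedule

end Workload

end SpinLock

/-! ### The response-time bound -/

theorem mainTheorem2 {ι ρ : Type*} [Fintype ι] [DecidableEq ι] [Fintype ρ] [DecidableEq ρ]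
    {V : ι → Type*} [∀ i, Fintype (V i)]
    (S : SpinLock.TaskSystem ι ρ V) (W : SpinLock.Workload S) (σ : W.Trace)
    (hσ : W.IsSchedule σ)
    (hdeadline : ∀ k, W.wcrt σ k ≤ ((S.deadline k : ℝ) : EReal) ∨
      S.unorderedBound k ≤ S.deadline k)
    (i : ι) :
    W.wcrt σ i ≤ ((S.unorderedBound i : ℝ) : EReal) := by
  rcases le_or_gt (S.unorderedBound i) (S.deadline i) with h | h
  · refine iSup₂_le fun k hk => ?_
    have hfin := hσ.jobFinished_of_previous hk h fun j l hl _ t ht =>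
      hσ.jobFinished_of_deadline_lt hdeadline hl ht
    rw [SpinLock.Workload.responseTime,
      EReal.sub_le_iff_le_add (Or.inl (EReal.coe_ne_bot _)) (Or.inl (EReal.coe_ne_top _))]
    rw [add_comm, ← EReal.coe_add, SpinLock.Workload.finishTime]
    exact sInf_le ⟨_, hfin, rfl⟩
  -- If `B > D`, the task must be schedulable by hypothesis, and `R ≤ D < B`.
  · rcases hdeadline i with h' | h'
    · exact h'.trans (EReal.coe_le_coe_iff.2 h.le)
    · exact absurd h' (not_le.2 h)
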